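/- Let $G$ be an infinite connected simple undirected graph that is vertex-transitive (for any two vertices $u, v$ there is an automorphism of $G$ mapping $u$ to $v$) and has bounded degree (there is a finite number $D$ such that every vertex has at most $D$ neighbours). Then $G$ has a perfect matching, that is, a set of edges of $G$ such that every vertex of $G$ is incident with exactly one edge of the set. -/

import Mathlib

/-- A graph is vertex-transitive if its automorphism group acts transitively on the vertices. -/
def IsVertexTransitive {V : Type*} (G : SimpleGraph V) : Prop :=
  ∀ u v : V, ∃ φ : G ≃g G, φ u = v

/-- A graph has bounded degree if some finite number bounds the number of neighbours of every
vertex. The count is taken in `ℕ∞`, so a vertex with infinitely many neighbours is excluded. -/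
def HasBoundedDegree {V : Type*} (G : SimpleGraph V) : Prop :=
  ∃ D : ℕ, ∀ v : V, (G.neighborSet v).encard ≤ D

namespace SimpleGraph

open Finset

/-! The graph is `d`-regular, and `le_boundaryCard` shows that every nonempty finite set sends out
at least `d` edges. A finite set `S` receives at most `d * #S` edges, so it cuts off at most `#S`
finite pieces: Tutte's condition. Tutte's theorem for finite graphs then matches any finite `F`
inside an auxiliary finite graph, and compactness of the product of the finite neighbour sets glues
these matchings. -/

lemma Connected.exists_adj_notMem {V : Type*} [Infinite V] {G : SimpleGraph V}
    (hG : G.Connected) {A : Finset V} (hA : A.Nonempty) : ∃ x ∈ A, ∃ y ∉ A, G.Adj x y := by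
  obtain ⟨a, ha⟩ := hA
  obtain ⟨b, hb⟩ := Infinite.exists_notMem_finset A
  obtain ⟨p⟩ := hG.preconnected a b
  obtain ⟨e, -, h1, h2⟩ := p.exists_boundary_dart (A : Set V) ha hb
  exact ⟨e.fst, h1, e.snd, h2, e.adj⟩

lemma Iso.map_neighborFinset {V : Type*} {G : SimpleGraph V} [G.LocallyFinite] (φ : G ≃g G) (x : V) :
    (G.neighborFinset x).map φ.toEquiv.toEmbedding = G.neighborFinset (φ x) := by
  ext y
  obtain ⟨z, rfl⟩ := φ.surjective y
  rw [mem_neighborFinset, φ.map_adj_iff, ← mem_neighborFinset]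
  exact mem_map' φ.toEquiv.toEmbedding

/-! ### Edge boundaries and atoms -/

section Boundary

variable {V : Type*} [DecidableEq V] (G : SimpleGraph V) [G.LocallyFinite]

/-- The number of edges leaving a finite set of vertices. -/
def boundaryCard (A : Finset V) : ℕ := ∑ x ∈ A, #(G.neighborFinset x \ A)

/-- The number of ordered pairs of adjacent vertices in a finite set of vertices. -/
def innerCard (A : Finset V) : ℕ := ∑ x ∈ A, #(G.neighborFinset x ∩ A)

variable {G}

lemma innerCard_eq_card_sigma (A : Finset V) :
    G.innerCard A = #(A.sigma fun x ↦ G.neighborFinset x ∩ A) := (card_sigma _ _).symm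

lemma innerCard_add_innerCard_le (A B : Finset V) :
    G.innerCard A + G.innerCard B ≤ G.innerCard (A ∪ B) + G.innerCard (A ∩ B) := by
  simp only [innerCard_eq_card_sigma]
  rw [← card_union_add_card_inter]
  refine Nat.add_le_add (card_le_card fun p ↦ ?_) (card_le_card fun p ↦ ?_)
  · simp only [mem_union, mem_sigma, mem_inter]
    tauto
  · simp only [mem_sigma, mem_inter]
    tauto

lemma innerCard_add_boundaryCard {d : ℕ} (hd : G.IsRegularOfDegree d) (A : Finset V) :
    G.innerCard A + G.boundaryCard A = d * #A := by
  rw [innerCard, boundaryCard, ← sum_add_distrib, mul_comm, ← smul_eq_mul]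
  refine sum_eq_card_nsmul fun x _ ↦ ?_
  rw [card_inter_add_card_sdiff, card_neighborFinset_eq_degree, hd x]

lemma boundaryCard_submodular {d : ℕ} (hd : G.IsRegularOfDegree d) (A B : Finset V) :
    G.boundaryCard (A ∪ B) + G.boundaryCard (A ∩ B) ≤ G.boundaryCard A + G.boundaryCard B := by
  have h := innerCard_add_innerCard_le (G := G) A B
  have hA := innerCard_add_boundaryCard hd A
  have hB := innerCard_add_boundaryCard hd B
  have hU := innerCard_add_boundaryCard hd (A ∪ B)
  have hI := innerCard_add_boundaryCard hd (A ∩ B)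
  have hc : d * #(A ∪ B) + d * #(A ∩ B) = d * #A + d * #B := by
    rw [← mul_add, ← mul_add, card_union_add_card_inter]
  omega

lemma boundaryCard_map (φ : G ≃g G) (A : Finset V) :
    G.boundaryCard (A.map φ.toEquiv.toEmbedding) = G.boundaryCard A := by
  rw [boundaryCard, sum_map]
  refine sum_congr rfl fun x _ ↦ ?_
  conv_rhs => rw [← card_map φ.toEquiv.toEmbedding, Finset.map_sdiff, φ.map_neighborFinset]
  rfl

/-- There is a nonempty finite set with the fewest edges leaving it, and of least cardinality among
those, a so-called atom. -/
lemma exists_atom [Nonempty V] (G : SimpleGraph V) [G.LocallyFinite] :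
    ∃ A : Finset V, A.Nonempty ∧ (∀ B : Finset V, B.Nonempty → G.boundaryCard A ≤ G.boundaryCard B) ∧
      ∀ B : Finset V, B.Nonempty → G.boundaryCard B = G.boundaryCard A → #A ≤ #B := by
  obtain ⟨v⟩ := ‹Nonempty V›
  have key : ∃ A, MinimalFor (fun A : Finset V ↦ A.Nonempty)
      (fun A ↦ toLex (G.boundaryCard A, #A)) A :=
    exists_minimalFor_of_wellFoundedLT _ _ ⟨{v}, singleton_nonempty v⟩
  obtain ⟨A, hA, hmin⟩ := key
  have h (B : Finset V) (hB : B.Nonempty) : toLex (G.boundaryCard A, #A) ≤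
      toLex (G.boundaryCard B, #B) := by
    by_contra hlt
    exact hlt (hmin hB (not_le.1 hlt).le)
  simp only [Prod.Lex.toLex_le_toLex] at h
  refine ⟨A, hA, fun B hB ↦ ?_, fun B hB hBA ↦ ?_⟩
  · rcases h B hB with h | h <;> omega
  · rcases h B hB with h | h <;> omega

/-- In an infinite connected vertex-transitive graph of degree `d`, at least `d` edges leave every
nonempty finite set of vertices. -/
theorem le_boundaryCard [Infinite V] (hG : G.Connected) (ht : IsVertexTransitive G) {d : ℕ}
    (hd : G.IsRegularOfDegree d) {B : Finset V} (hB : B.Nonempty) : d ≤ G.boundaryCard B := by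
  obtain ⟨A, ⟨a, ha⟩, hmin, hcard⟩ := G.exists_atom
  refine le_trans ?_ (hmin B hB)
  have hinv (φ : G ≃g G) (hφ : φ a ∈ A) : A.map φ.toEquiv.toEmbedding = A := by
    set C := A.map φ.toEquiv.toEmbedding with hC
    have hne : (A ∩ C).Nonempty := ⟨φ a, mem_inter.2 ⟨hφ, mem_map.2 ⟨a, ha, rfl⟩⟩⟩
    have h1 := boundaryCard_submodular hd A C
    have h2 := hmin _ hne
    have h3 := hmin (A ∪ C) ⟨a, mem_union_left _ ha⟩
    have h4 : G.boundaryCard C = G.boundaryCard A := boundaryCard_map φ A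
    -- Submodularity and minimality force `A ∩ C` to have minimal boundary too, so an atom equals
    -- each translate that it meets in this way.
    have h5 := hcard _ hne (by omega)
    have h6 : A ∩ C = A := eq_of_subset_of_card_le inter_subset_left h5
    exact (eq_of_subset_of_card_le (inter_eq_left.1 h6) (by rw [hC, card_map])).symm
  have hconst (b : V) (hb : b ∈ A) : #(G.neighborFinset b \ A) = #(G.neighborFinset a \ A) := by
    obtain ⟨φ, rfl⟩ := ht a b
    conv_lhs => rw [← hinv φ hb, ← φ.map_neighborFinset, ← Finset.map_sdiff, card_map]
  have hsum : G.boundaryCard A = #A * #(G.neighborFinset a \ A) := by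
    rw [boundaryCard, sum_congr rfl hconst, sum_const, smul_eq_mul]
  have hpos : 0 < #(G.neighborFinset a \ A) := by
    obtain ⟨x, hx, y, hy, hxy⟩ := hG.exists_adj_notMem ⟨a, ha⟩
    rw [← hconst x hx]
    exact card_pos.2 ⟨y, by simp [hy, hxy]⟩
  have hdeg : #(G.neighborFinset a ∩ A) + #(G.neighborFinset a \ A) = d := by
    rw [card_inter_add_card_sdiff, card_neighborFinset_eq_degree, hd a]
  have hlt : #(G.neighborFinset a ∩ A) < #A :=
    card_lt_card ⟨inter_subset_right, fun h ↦ by simpa using h ha⟩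
  rw [hsum]
  -- With `k ≥ 1` outside neighbours per vertex, `#A ≥ d - k + 1`, and `(d - k + 1) * k = d + (d -
  -- k) * (k - 1) ≥ d`.
  nlinarith

/-- Pairwise disjoint nonempty finite sets of vertices whose neighbours outside lie in `S` number at
most `#S`. -/
theorem card_le_card_of_neighbors_subset [Infinite V] (hG : G.Connected)
    (ht : IsVertexTransitive G) {d : ℕ} (hd : G.IsRegularOfDegree d) {ι : Type*} (I : Finset ι)
    (A : ι → Finset V) (S : Finset V) (hdisj : (I : Set ι).PairwiseDisjoint A)
    (hne : ∀ i ∈ I, (A i).Nonempty)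
    (hS : ∀ i ∈ I, ∀ x ∈ A i, ∀ y, G.Adj x y → y ∈ A i ∨ y ∈ S) : #I ≤ #S := by
  classical
  have hpos : 0 < d := by
    obtain ⟨v⟩ := hG.nonempty
    obtain ⟨x, -, y, -, hxy⟩ := hG.exists_adj_notMem (singleton_nonempty v)
    rw [← hd x, ← card_neighborFinset_eq_degree]
    exact card_pos.2 ⟨y, by simpa using hxy⟩
  refine Nat.le_of_mul_le_mul_left ?_ hpos
  set U := I.disjiUnion A hdisj
  calc d * #I = ∑ i ∈ I, d := by rw [sum_const, smul_eq_mul, mul_comm]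
    _ ≤ ∑ i ∈ I, G.boundaryCard (A i) := sum_le_sum fun i hi ↦ le_boundaryCard hG ht hd (hne i hi)
    _ ≤ ∑ i ∈ I, ∑ x ∈ A i, #{y ∈ S | G.Adj x y} := by
        refine sum_le_sum fun i hi ↦ sum_le_sum fun x hx ↦ card_le_card fun y hy ↦ ?_
        rw [mem_sdiff, mem_neighborFinset] at hy
        exact mem_filter.2 ⟨(hS i hi x hx y hy.1).resolve_left hy.2, hy.1⟩
    _ = ∑ x ∈ U, #{y ∈ S | G.Adj x y} := (sum_disjiUnion _ _ _).symm
    _ = ∑ y ∈ S, #{x ∈ U | G.Adj x y} := sum_card_bipartiteAbove_eq_sum_card_bipartiteBelow _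
    _ ≤ ∑ y ∈ S, d := by
        refine sum_le_sum fun y _ ↦ ?_
        rw [← hd y, ← card_neighborFinset_eq_degree]
        refine card_le_card fun x hx ↦ ?_
        rw [mem_neighborFinset]
        exact (mem_filter.1 hx).2.symm
    _ = d * #S := by rw [sum_const, smul_eq_mul, mul_comm]

end Boundary

/-! ### Compactness -/

section Compactness

variable {V : Type*} {G : SimpleGraph V}

/-- If every finite set of vertices of a locally finite graph can be matched, then the graph has a
perfect matching. -/
theorem exists_isPerfectMatching_of_forall_finset (hfin : ∀ v, (G.neighborSet v).Finite)
    (h : ∀ F : Finset V, ∃ f : V → V, (∀ v, G.Adj v (f v)) ∧ ∀ v ∈ F, f (f v) = v) :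
    ∃ M : G.Subgraph, M.IsPerfectMatching := by
  let _ : TopologicalSpace V := ⊥
  have : DiscreteTopology V := ⟨rfl⟩
  have (v : V) : Finite (G.neighborSet v) := hfin v
  let C (v : V) : Set (Π v, G.neighborSet v) := {f | (f (f v : V) : V) = v}
  have hC (v : V) : IsClosed (C v) := by
    -- Fixing the value `w` of `f v` leaves a condition on just two coordinates.
    have : C v = ⋂ w : G.neighborSet v, {f | f v = w → (f (w : V) : V) = v} := by
      ext f
      simp only [C, Set.mem_iInter, Set.mem_ofPred_eq]
      exact ⟨fun h w hw ↦ hw ▸ h, fun h ↦ h _ rfl⟩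
    rw [this]
    refine isClosed_iInter fun w ↦ ?_
    exact (isClosed_discrete {p : G.neighborSet v × G.neighborSet (w : V) |
      p.1 = w → (p.2 : V) = v}).preimage
        (f := fun f : Π v, G.neighborSet v ↦ (f v, f (w : V))) (by fun_prop)
  have hne : (⋂ v, C v).Nonempty := by
    by_contra hempty
    rw [Set.not_nonempty_iff_eq_empty, ← Set.univ_inter (⋂ v, C v)] at hempty
    obtain ⟨F, hF⟩ := isCompact_univ.elim_finite_subfamily_closed C hC hempty
    obtain ⟨f, hf, hfF⟩ := h F
    have hmem : (fun v ↦ ⟨f v, hf v⟩ : Π v, G.neighborSet v) ∈ ⋂ v ∈ F, C v := by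
      simpa [C] using hfF
    rwa [← Set.univ_inter (⋂ v ∈ F, C v), hF] at hmem
  obtain ⟨f, hf⟩ := hne
  have hf (v : V) : (f (f v : V) : V) = v := Set.mem_iInter.1 hf v
  refine ⟨{ verts := Set.univ
            Adj := fun v w ↦ (f v : V) = w
            adj_sub := ?_
            edge_vert := fun _ ↦ Set.mem_univ _
            symm := ⟨?_⟩ }, ?_⟩
  · rintro v _ rfl
    exact (f v).2
  · rintro v _ rfl
    exact hf v
  · rw [Subgraph.isPerfectMatching_iff]
    exact fun v ↦ ⟨f v, rfl, fun w (hw : (f v : V) = w) ↦ Eq.symm hw⟩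

end Compactness

/-! ### Tutte's theorem on finite pieces -/

section Transitive

variable {V : Type*} {G : SimpleGraph V}

/-- The graph on a finite set `W` of vertices in which the edges of `G` are kept and all vertices
outside `F` are made adjacent. -/
def cliqueOutside (G : SimpleGraph V) (F W : Finset V) : SimpleGraph W where
  Adj u v := G.Adj u v ∨ u ≠ v ∧ (u : V) ∉ F ∧ (v : V) ∉ F
  symm := ⟨fun u v h ↦ by
    rcases h with h | ⟨h1, h2, h3⟩
    exacts [Or.inl h.symm, Or.inr ⟨h1.symm, h3, h2⟩]⟩
  loopless := ⟨fun u h ↦ by simp at h⟩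

/-- Odd components inside `F` number at most `#u` by the edge count. The clique allows only one
more, and parity rules out an excess of exactly one. -/
lemma not_isTutteViolator_cliqueOutside [DecidableEq V] [G.LocallyFinite] [Infinite V]
    (hG : G.Connected) (ht : IsVertexTransitive G) {d : ℕ} (hd : G.IsRegularOfDegree d)
    {F W : Finset V} (hW : Even #W) (hFW : ∀ x ∈ F, ∀ y, G.Adj x y → y ∈ W) (u : Set W) :
    ¬ (G.cliqueOutside F W).IsTutteViolator u := by
  classical
  intro hu
  rw [IsTutteViolator] at hu
  set K := ((⊤ : (G.cliqueOutside F W).Subgraph).deleteVerts u).coe with hK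
  let π : ((⊤ : (G.cliqueOutside F W).Subgraph).deleteVerts u).verts ↪ V :=
    (Function.Embedding.subtype _).trans (Function.Embedding.subtype _)
  let A (c : K.ConnectedComponent) : Finset V := c.supp.toFinset.map π
  let I : Finset K.ConnectedComponent := {c ∈ K.oddComponents.toFinset | A c ⊆ F}
  let J : Finset K.ConnectedComponent := {c ∈ K.oddComponents.toFinset | ¬ A c ⊆ F}
  have hIJ : #I + #J = K.oddComponents.ncard := by
    rw [Set.ncard_eq_toFinset_card']
    exact card_filter_add_card_filter_not (fun c ↦ A c ⊆ F)
  have hmemA {c : K.ConnectedComponent} {x : V} :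
      x ∈ A c ↔ ∃ z, K.connectedComponentMk z = c ∧ π z = x := by
    simp [A]
  have hI : #I ≤ u.ncard := by
    rw [Set.ncard_eq_toFinset_card', ← card_map (Function.Embedding.subtype _)]
    refine card_le_card_of_neighbors_subset hG ht hd I A _ ?_ ?_ ?_
    · intro c _ c' _ hcc
      rw [Function.onFun, Finset.disjoint_left]
      intro x hx hx'
      obtain ⟨z, rfl, rfl⟩ := hmemA.1 hx
      obtain ⟨z', rfl, hz⟩ := hmemA.1 hx'
      exact hcc (by rw [π.injective hz])
    · intro c _
      obtain ⟨z, hz⟩ := c.nonempty_supp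
      exact ⟨π z, hmemA.2 ⟨z, hz, rfl⟩⟩
    · intro c hc x hx y hxy
      have hyW := hFW x ((mem_filter.1 hc).2 hx) y hxy
      obtain ⟨z, rfl, rfl⟩ := hmemA.1 hx
      by_cases hy : (⟨y, hyW⟩ : W) ∈ u
      · right
        simpa using ⟨hyW, hy⟩
      · left
        refine hmemA.2 ⟨⟨⟨y, hyW⟩, by simpa using hy⟩, ?_, rfl⟩
        refine (ConnectedComponent.connectedComponentMk_eq_of_adj ?_).symm
        have hz := z.2
        simp only [Subgraph.deleteVerts_verts, Subgraph.verts_top, Set.mem_sdiff, Set.mem_univ,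
          true_and] at hz
        simp only [hK, Subgraph.coe_adj, Subgraph.deleteVerts_adj, Subgraph.verts_top,
          Set.mem_univ, true_and, Subgraph.top_adj]
        exact ⟨hz, hy, Or.inl hxy⟩
  have hJ : #J ≤ 1 := by
    refine card_le_one.2 fun c hc c' hc' ↦ ?_
    obtain ⟨x, hx, hxF⟩ := not_subset.1 (mem_filter.1 hc).2
    obtain ⟨x', hx', hxF'⟩ := not_subset.1 (mem_filter.1 hc').2
    obtain ⟨z, rfl, rfl⟩ := hmemA.1 hx
    obtain ⟨z', rfl, rfl⟩ := hmemA.1 hx'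
    by_cases hzz : z = z'
    · rw [hzz]
    refine ConnectedComponent.connectedComponentMk_eq_of_adj ?_
    have hz := z.2
    have hz' := z'.2
    simp only [Subgraph.deleteVerts_verts, Subgraph.verts_top, Set.mem_sdiff, Set.mem_univ,
      true_and] at hz hz'
    simp only [hK, Subgraph.coe_adj, Subgraph.deleteVerts_adj, Subgraph.verts_top,
      Set.mem_univ, true_and, Subgraph.top_adj]
    exact ⟨hz, hz', Or.inr ⟨fun h ↦ hzz (Subtype.ext h), hxF, hxF'⟩⟩
  have hodd := K.odd_ncard_oddComponents
  have hcard : Nat.card ((⊤ : (G.cliqueOutside F W).Subgraph).deleteVerts u).verts + u.ncard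
      = #W := by
    rw [Nat.card_coe_set_eq, Subgraph.deleteVerts_verts, Subgraph.verts_top,
      Set.ncard_sdiff_add_ncard_of_subset (Set.subset_univ u), Set.ncard_univ]
    simp
  have : ¬ Odd (K.oddComponents.ncard + u.ncard) := by
    rw [← hcard] at hW
    rw [Nat.not_odd_iff_even]
    rw [Nat.even_add, ← Nat.not_odd_iff_even] at hW ⊢
    rw [hodd, hW]
  exact this ⟨u.ncard, by omega⟩

lemma exists_matching_of_finset [G.LocallyFinite] [Infinite V]
    (hG : G.Connected) (ht : IsVertexTransitive G) {d : ℕ} (hd : G.IsRegularOfDegree d)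
    (F : Finset V) : ∃ f : V → V, (∀ v, G.Adj v (f v)) ∧ ∀ v ∈ F, f (f v) = v := by
  classical
  obtain ⟨W, hFW, hNW, hW⟩ : ∃ W : Finset V, F ⊆ W ∧ (∀ x ∈ F, ∀ y, G.Adj x y → y ∈ W) ∧
      Even #W := by
    set W₀ := F ∪ F.biUnion fun x ↦ G.neighborFinset x with hW₀
    have hN : ∀ x ∈ F, ∀ y, G.Adj x y → y ∈ W₀ := fun x hx y hxy ↦
      mem_union_right _ (mem_biUnion.2 ⟨x, hx, by simpa using hxy⟩)
    by_cases he : Even #W₀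
    · exact ⟨W₀, subset_union_left, hN, he⟩
    · obtain ⟨b, hb⟩ := Infinite.exists_notMem_finset W₀
      refine ⟨insert b W₀, subset_union_left.trans (subset_insert _ _),
        fun x hx y hxy ↦ mem_insert_of_mem (hN x hx y hxy), ?_⟩
      rw [card_insert_of_notMem hb]
      exact (Nat.not_even_iff_odd.1 he).add_one
  obtain ⟨M, hM⟩ := tutte.2 (not_isTutteViolator_cliqueOutside hG ht hd hW hNW)
  rw [Subgraph.isPerfectMatching_iff] at hM
  choose p hp hpu using hM
  have hnbr (v : V) : ∃ w, G.Adj v w := by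
    obtain ⟨x, hx, y, -, hxy⟩ := hG.exists_adj_notMem (singleton_nonempty v)
    exact ⟨y, mem_singleton.1 hx ▸ hxy⟩
  choose g hg using hnbr
  -- Auxiliary clique edges are discarded for an arbitrary neighbour; they never touch `F`.
  let f (v : V) : V := if h : ∃ hv : v ∈ W, G.Adj v (p ⟨v, hv⟩) then p ⟨v, h.1⟩ else g v
  have hf (w : W) (h : G.Adj w (p w)) : f w = p w := dif_pos ⟨w.2, h⟩
  refine ⟨f, fun v ↦ ?_, fun v hv ↦ ?_⟩
  · by_cases h : ∃ hv : v ∈ W, G.Adj v (p ⟨v, hv⟩)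
    · simpa only [f, dif_pos h] using h.2
    · simpa only [f, dif_neg h] using hg v
  · let w : W := ⟨v, hFW hv⟩
    have hadj : G.Adj w (p w) := (M.adj_sub (hp w)).resolve_right fun h ↦ h.2.1 hv
    have hpp : p (p w) = w := (hpu (p w) w (hp w).symm).symm
    have h1 : f v = p w := hf w hadj
    rw [h1, hf (p w) (by rw [hpp]; exact hadj.symm), hpp]

end Transitive

end SimpleGraph

theorem mainTheorem11 {V : Type*} [Infinite V] (G : SimpleGraph V)
    (hconn : G.Connected) (htrans : IsVertexTransitive G) (hdeg : HasBoundedDegree G) :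
    ∃ M : G.Subgraph, M.IsPerfectMatching := by
  obtain ⟨D, hD⟩ := hdeg
  have hfin (v : V) : (G.neighborSet v).Finite := Set.finite_of_encard_le_coe (hD v)
  let _ : G.LocallyFinite := fun v ↦ (hfin v).fintype
  obtain ⟨o⟩ := hconn.nonempty
  have hd : G.IsRegularOfDegree (G.degree o) := fun v ↦ by
    obtain ⟨φ, rfl⟩ := htrans o v
    exact φ.degree_eq o
  exact SimpleGraph.exists_isPerfectMatching_of_forall_finset hfin
    (SimpleGraph.exists_matching_of_finset hconn htrans hd)
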